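/- A *hypergraph* $H=(E_i : i\in I)$ is a finite list of finite nonempty subsets $E_i$ (edges) of $\mathbf{N}=\{1,2,3,\dots\}$; repeated edges are allowed, and $H$ is *simple* if $E_i\ne E_j$ whenever $i\neq j$. Its vertices are the elements of $\bigcup_{i\in I}E_i$, and its *weight* is $\sum_{i\in I}|E_i|$. Two hypergraphs $(E_i : i\in I)$ and $(E'_i : i\in I')$ are *isomorphic* if there are an increasing bijection $F:\bigcup_{i\in I'}E'_i\to\bigcup_{i\in I}E_i$ and a bijection $f:I'\to I$ with $F(E'_i)=E_{f(i)}$ for all $i\in I'$. Let $h'_n$ be the number of nonisomorphic simple hypergraphs of weight $n$, let $h''_n$ be the number of all nonisomorphic hypergraphs of weight $n$, and let $b_n$ be the $n$-th Bell number, i.e. the number of partitions of $\{1,\dots,n\}$. For every integer $n\ge 1$, $$b_n\le h'_n\le h''_n\le 2^{n-1}b_n .$$ For $n\to\infty$, $$\log h''_n=\log b_n+O(n)=n(\log n-\log\log n+O(1)),$$ and the same holds for $h'_n$, that is, $\log h'_n=\log b_n+O(n)=n(\log n-\log\log n+O(1))$. -/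

import Mathlib

open Filter Asymptotics

/-- A hypergraph on the linearly ordered vertex universe `{1, 2, 3, …}`: a finite list
`(E_i : i ∈ I)` of finite nonempty sets of positive integers, with `I = Fin size`.
Repetitions in the list are allowed, and there are no isolated vertices. -/
structure OrderedHypergraph where
  /-- the number of edges -/
  size : ℕ
  /-- the list of edges -/
  edge : Fin size → Finset ℕ+
  /-- edges are nonempty -/
  edge_nonempty : ∀ i, (edge i).Nonempty

namespace OrderedHypergraph

/-- The vertices of `H` are the elements of the union of its edges. -/
def vertices (H : OrderedHypergraph) : Finset ℕ+ :=
  Finset.univ.biUnion H.edge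

/-- `H` is simple if edges with distinct indices are distinct sets. -/
def IsSimple (H : OrderedHypergraph) : Prop :=
  ∀ i j, i ≠ j → H.edge i ≠ H.edge j

/-- The weight of `H`: the number of incidences between vertices and edges. -/
def weight (H : OrderedHypergraph) : ℕ :=
  ∑ i, (H.edge i).card

/-- Ordered isomorphism: an increasing bijection `F` between the vertex sets and a bijection `f`
between the index sets such that `F` maps the edge with index `i` onto the edge with index `f i`.
As `F` is a bijection between the unions of the edges, the latter says that a vertex `v` lies in
the `i`-th edge of `H` iff `F v` lies in the `f i`-th edge of `K`. -/
def Iso (H K : OrderedHypergraph) : Prop :=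
  ∃ (F : H.vertices ≃o K.vertices) (f : Fin H.size ≃ Fin K.size),
    ∀ (i : Fin H.size) (v : H.vertices), (v : ℕ+) ∈ H.edge i ↔ (F v : ℕ+) ∈ K.edge (f i)

theorem Iso.refl (H : OrderedHypergraph) : Iso H H :=
  ⟨OrderIso.refl _, Equiv.refl _, fun _ _ => Iff.rfl⟩

theorem Iso.symm {H K : OrderedHypergraph} : Iso H K → Iso K H := by
  rintro ⟨F, f, h⟩
  refine ⟨F.symm, f.symm, fun i v => ?_⟩
  have := h (f.symm i) (F.symm v)
  simpa using this.symm

theorem Iso.trans {H K L : OrderedHypergraph} : Iso H K → Iso K L → Iso H L := by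
  rintro ⟨F, f, h⟩ ⟨G, g, k⟩
  exact ⟨F.trans G, f.trans g, fun i v => (h i v).trans (k (f i) (F v))⟩

/-- Ordered isomorphism as an equivalence relation. -/
def isoSetoid : Setoid OrderedHypergraph where
  r := Iso
  iseqv := ⟨Iso.refl, Iso.symm, Iso.trans⟩

/-- `h'_n`: the number of nonisomorphic simple hypergraphs of weight `n`, that is, of isomorphism
classes that contain such a hypergraph. -/
noncomputable def numSimple (n : ℕ) : ℕ :=
  (Quotient.mk isoSetoid '' {H | H.IsSimple ∧ H.weight = n}).ncard

/-- `h''_n`: the number of nonisomorphic hypergraphs of weight `n`, simple or not. -/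
noncomputable def numAll (n : ℕ) : ℕ :=
  (Quotient.mk isoSetoid '' {H | H.weight = n}).ncard

end OrderedHypergraph

/-! For the lower bound, the classes of a partition of {1, …, n} form a simple hypergraph of weight
n. An increasing bijection of {1, …, n} is the identity, so distinct partitions give nonisomorphic
hypergraphs (`eq_of_iso_ofSetoid`).

For the upper bound, list the n incidences by increasing vertex. Up to isomorphism the hypergraph is
recovered from the set of places, among n - 1, where the vertex changes, and the partition of the n
positions by edge (`exists_code`). This gives at most 2^(n-1) b_n classes, and the factor 2^(n-1)
costs only O(n) in the logarithm.

The growth of log b_n follows from k^(n-k) ≤ b_n with k about n / log n, and from a saddle-point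
bound on the generating function at (log n) / 2. -/

namespace Setoid

/-! ### Bell numbers as counts of equivalence relations -/

theorem finite_of_finite {α : Type*} [Finite α] : Finite (Setoid α) :=
  Finite.of_injective (fun r : Setoid α => fun x y => r x y) fun _ _ h =>
    Setoid.ext fun x y => iff_of_eq (congrFun (congrFun h x) y)

/-- Equivalence relations on `Option α` for which `s` is the set of elements of `α` not related to
`none` correspond to equivalence relations on `s`. -/
noncomputable def optionFiberEquiv {α : Type*} (s : Set α) :
    {r : Setoid (Option α) // {a | ¬ r none (some a)} = s} ≃ Setoid s where
  toFun r := r.1.comap fun a : s => some (a : α)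
  invFun t :=
    ⟨{ r := fun x y => ((∀ a ∈ x, a ∉ s) ∧ ∀ b ∈ y, b ∉ s) ∨
          ∃ a b : s, x = some (a : α) ∧ y = some (b : α) ∧ t a b
       iseqv := by
        refine ⟨fun x => ?_, ?_, ?_⟩
        · by_cases h : ∀ a ∈ x, a ∉ s
          · exact Or.inl ⟨h, h⟩
          · push Not at h
            obtain ⟨a, ha, has⟩ := h
            exact Or.inr ⟨⟨a, has⟩, ⟨a, has⟩, ha, ha, t.refl _⟩
        · rintro x y (⟨h, h'⟩ | ⟨a, b, ha, hb, h⟩)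
          · exact Or.inl ⟨h', h⟩
          · exact Or.inr ⟨b, a, hb, ha, t.symm h⟩
        · rintro x y z (⟨h, h'⟩ | ⟨a, b, ha, hb, h⟩) (⟨k, k'⟩ | ⟨c, d, hc, hd, k⟩)
          · exact Or.inl ⟨h, k'⟩
          · exact absurd c.2 (h' c hc)
          · exact absurd b.2 (k b hb)
          · obtain rfl : b = c := Subtype.ext (Option.some_injective _ (hb.symm.trans hc))
            exact Or.inr ⟨a, d, ha, hd, t.trans h k⟩ }, by
      ext a
      constructor
      · intro h
        by_contra ha
        exact h (Or.inl ⟨by simp, by simpa using ha⟩)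
      · rintro ha (⟨-, h⟩ | ⟨b, c, hb, -⟩)
        · exact h a rfl ha
        · simp at hb⟩
  left_inv := by
    rintro ⟨r, rfl⟩
    have key : ∀ x, (∀ a ∈ x, a ∉ {a | ¬ r none (some a)}) ↔ r none x := by
      rintro (_ | a)
      · simp
      · simp
    refine Subtype.ext (Setoid.ext fun x y => ?_)
    change ((∀ a ∈ x, a ∉ _) ∧ ∀ a ∈ y, a ∉ _) ∨ _ ↔ _
    rw [key, key]
    constructor
    · rintro (⟨h, k⟩ | ⟨a, b, rfl, rfl, h⟩)
      · exact r.trans (r.symm h) k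
      · exact h
    · intro h
      by_cases hx : r none x
      · exact Or.inl ⟨hx, r.trans hx h⟩
      · have hy : ¬ r none y := fun hy => hx (r.trans hy (r.symm h))
        rcases x with _ | a
        · exact absurd (r.refl none) hx
        rcases y with _ | b
        · exact absurd (r.refl none) hy
        exact Or.inr ⟨⟨a, hx⟩, ⟨b, hy⟩, rfl, rfl, h⟩
  right_inv t := by
    refine Setoid.ext fun a b => ?_
    constructor
    · rintro (⟨h, -⟩ | ⟨c, d, hc, hd, h⟩)
      · exact absurd a.2 (h a rfl)
      · obtain rfl : a = c := Subtype.ext (Option.some_injective _ hc)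
        obtain rfl : b = d := Subtype.ext (Option.some_injective _ hd)
        exact h
    · exact fun h => Or.inr ⟨a, b, rfl, rfl, h⟩

/-- Equivalent types carry equally many equivalence relations. -/
def congrEquiv {α β : Type*} (e : α ≃ β) : Setoid α ≃ Setoid β where
  toFun r := r.comap e.symm
  invFun r := r.comap e
  left_inv r := by ext; simp [Setoid.comap_rel]
  right_inv r := by ext; simp [Setoid.comap_rel]

/-- The Bell numbers count equivalence relations. -/
theorem natCard_eq_bell {α : Type*} [Finite α] : Nat.card (Setoid α) = Nat.bell (Nat.card α) := by
  suffices ∀ n, Nat.card (Setoid (Fin n)) = n.bell by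
    rw [← this, Nat.card_congr (congrEquiv (Finite.equivFin α))]
  intro n
  induction n using Nat.strong_induction_on with
  | _ n ih =>
  classical
  cases n with
  | zero =>
    have : Unique (Setoid (Fin 0)) := ⟨⟨⊥⟩, fun r => Setoid.ext fun x => x.elim0⟩
    simp
  | succ n =>
    -- Split by the set `s` of points outside the class of one distinguished point; what remains is
    -- an arbitrary partition of `s`.
    have e : Setoid (Fin (n + 1)) ≃ Σ s : Finset (Fin n), Setoid (Fin s.card) :=
      calc
        Setoid (Fin (n + 1)) ≃ Setoid (Option (Fin n)) := congrEquiv (finSuccEquiv n)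
        _ ≃ Σ s : Set (Fin n), {r : Setoid (Option (Fin n)) // {a | ¬ r none (some a)} = s} :=
          (Equiv.sigmaFiberEquiv _).symm
        _ ≃ Σ s : Set (Fin n), Setoid s := Equiv.sigmaCongrRight optionFiberEquiv
        _ ≃ Σ s : Finset (Fin n), Setoid (s : Set (Fin n)) :=
          (Equiv.sigmaCongrLeft (β := fun s : Set (Fin n) => Setoid s)
            Fintype.finsetEquivSet).symm
        _ ≃ _ := Equiv.sigmaCongrRight fun s => congrEquiv s.equivFin
    have : ∀ m, Finite (Setoid (Fin m)) := fun m => finite_of_finite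
    rw [Nat.card_congr e, Nat.card_sigma]
    have : ∀ s : Finset (Fin n), Nat.card (Setoid (Fin s.card)) = s.card.bell := fun s =>
      ih _ (Nat.lt_succ_of_le (by simpa using s.card_le_univ))
    simp only [this]
    -- The Bell recurrence is indexed by the complement of `s`, hence the reflection of the sum.
    rw [← Finset.powerset_univ, Finset.sum_powerset_apply_card, Nat.bell_succ,
      ← Nat.range_succ_eq_Iic, ← Finset.sum_range_reflect]
    simp only [Finset.card_univ, Fintype.card_fin, smul_eq_mul]
    refine Finset.sum_congr rfl fun k hk => ?_
    have hk : k ≤ n := by simpa [Nat.lt_succ_iff] using hk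
    rw [show n + 1 - 1 - k = n - k by lia, Nat.choose_symm hk]

end Setoid

/-! ### Growth of the Bell numbers -/

/-- Partitions separating `k` given points. -/
theorem Nat.pow_le_bell_add (k m : ℕ) : k ^ m ≤ (k + m).bell := by
  have := Setoid.finite_of_finite (α := Fin k ⊕ Fin m)
  -- Each of the `m` further points `x` joins the class of the base point `f x`, so the partition
  -- remembers `f`.
  have h := Nat.card_le_card_of_injective
    (fun f : Fin m → Fin k => Setoid.ker (Sum.elim id f)) fun f g h => ?_
  · simpa [Setoid.natCard_eq_bell] using h
  · funext x
    have : (Setoid.ker (Sum.elim id g)) (Sum.inl (f x)) (Sum.inr x) :=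
      (Setoid.ext_iff.1 h _ _).1 (show Sum.elim id f (Sum.inl (f x)) = _ from rfl)
    exact this

theorem Nat.bell_pos (n : ℕ) : 0 < n.bell := by
  cases n with
  | zero => simp
  | succ n => simpa [add_comm, Nat.one_le_iff_ne_zero, Nat.pos_iff_ne_zero] using Nat.pow_le_bell_add 1 n

/-- The bound comes from the exponential generating function `exp (exp x - 1)`. -/
theorem Nat.bell_mul_pow_div_factorial_le {r : ℝ} (hr : 0 ≤ r) (n : ℕ) :
    n.bell * r ^ n / n.factorial ≤ Real.exp (r * Real.exp r) := by
  set M := r * Real.exp r with hM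
  have hM0 : 0 ≤ M := by positivity
  have hmono : Monotone fun n => ∑ k ∈ Finset.range (n + 1), M ^ k / k.factorial :=
    monotone_nat_of_le_succ fun n => by
      rw [Finset.sum_range_succ _ (n + 1)]
      exact le_add_of_nonneg_right (by positivity)
  -- Truncating the exponential series at degree `n` strengthens the induction: the factor 1 / (n +
  -- 1) of the recurrence turns each term of degree `k` into at most the term of degree `k + 1`.
  suffices n.bell * r ^ n / n.factorial ≤ ∑ k ∈ Finset.range (n + 1), M ^ k / k.factorial from
    this.trans (Real.sum_le_exp_of_nonneg hM0 _)
  induction n using Nat.strong_induction_on with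
  | _ n ih =>
  cases n with
  | zero => simp
  | succ n =>
    set T := ∑ k ∈ Finset.range (n + 1), M ^ k / k.factorial with hT
    have hT0 : 0 ≤ T := Finset.sum_nonneg fun k _ => by positivity
    calc
      ((n + 1).bell : ℝ) * r ^ (n + 1) / (n + 1).factorial
        = r / (n + 1) * ∑ k ∈ Finset.range (n + 1), r ^ k / k.factorial *
            ((n - k).bell * r ^ (n - k) / (n - k).factorial) := by
        rw [Nat.bell_succ, ← Nat.range_succ_eq_Iic, Nat.cast_sum, Finset.sum_mul, Finset.sum_div,
          Finset.mul_sum]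
        refine Finset.sum_congr rfl fun k hk => ?_
        have hk : k ≤ n := by simpa [Nat.lt_succ_iff] using hk
        have hr : r ^ (n + 1) = r ^ k * r ^ (n - k) * r := by
          rw [← pow_add, Nat.add_sub_cancel' hk, pow_succ]
        rw [Nat.cast_mul, Nat.cast_choose ℝ hk, Nat.factorial_succ, hr]
        push_cast
        field_simp
      _ ≤ r / (n + 1) * ∑ k ∈ Finset.range (n + 1), r ^ k / k.factorial * T := by
        gcongr with k hk
        exact (ih (n - k) (by lia)).trans (hmono (Nat.sub_le n k))
      _ ≤ r / (n + 1) * (Real.exp r * T) := by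
        rw [← Finset.sum_mul]
        gcongr
        exact Real.sum_le_exp_of_nonneg hr _
      _ = ∑ k ∈ Finset.range (n + 1), M ^ (k + 1) / (k.factorial * (n + 1)) := by
        rw [← mul_assoc, div_mul_eq_mul_div, ← hM, hT, Finset.mul_sum]
        refine Finset.sum_congr rfl fun k _ => ?_
        rw [pow_succ]
        field_simp
      _ ≤ ∑ k ∈ Finset.range (n + 1), M ^ (k + 1) / (k + 1).factorial := by
        gcongr with k hk
        rw [Nat.factorial_succ, mul_comm (k + 1)]
        push_cast
        have : (k : ℝ) ≤ n := by
          exact_mod_cast Nat.lt_succ_iff.1 (Finset.mem_range.1 hk)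
        gcongr
      _ ≤ ∑ k ∈ Finset.range (n + 1 + 1), M ^ k / k.factorial := by
        rw [Finset.sum_range_succ' _ (n + 1)]
        exact le_add_of_nonneg_right (by positivity)

theorem Nat.log_bell_le {n : ℕ} (hn : 3 ≤ n) :
    Real.log n.bell ≤ n * (Real.log n - Real.log (Real.log n)) + 2 * n := by
  have hn0 : (0 : ℝ) < n := by positivity
  set l := Real.log n with hl
  have hl0 : 0 < l := Real.log_pos (by exact_mod_cast (by lia : 1 < n))
  have hb : (0 : ℝ) < n.bell := by exact_mod_cast n.bell_pos
  -- With r = l / 2 one has exp r = √n, so the exponent r exp r is at most n.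
  have h := Real.log_le_log (by positivity)
    (Nat.bell_mul_pow_div_factorial_le (r := l / 2) (by positivity) n)
  rw [Real.log_exp, Real.log_div (by positivity) (by positivity),
    Real.log_mul (by positivity) (by positivity), Real.log_pow,
    Real.log_div (by positivity) two_ne_zero] at h
  have hexp : Real.exp (l / 2) = √n := by
    rw [Real.exp_half, hl, Real.exp_log hn0]
  have hM : l / 2 * Real.exp (l / 2) ≤ n := by
    have : l / 2 ≤ √n := by
      rw [← hexp]
      linarith [Real.add_one_le_exp (l / 2)]
    calc
      l / 2 * Real.exp (l / 2) ≤ √n * √n := by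
        rw [hexp]
        gcongr
      _ = n := Real.mul_self_sqrt hn0.le
  have hf : Real.log n.factorial ≤ n * l := by
    rw [hl, ← Real.log_pow]
    exact Real.log_le_log (by positivity) (by exact_mod_cast n.factorial_le_pow)
  nlinarith [Real.log_two_lt_d9]

/-- Take k = ⌈n / log n⌉ in k^(n-k) ≤ b_n: then log k ≥ log n - log log n, and the k lost factors
cost at most k log n ≤ n + log n ≤ 2n. The hypothesis on log n ensures k ≤ n. -/
theorem Nat.le_log_bell {n : ℕ} (hn : 2 ≤ Real.log n) :
    n * (Real.log n - Real.log (Real.log n)) - 2 * n ≤ Real.log n.bell := by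
  have hn0 : (0 : ℝ) < n := by
    by_contra h
    have : n = 0 := by simpa using h
    norm_num [this] at hn
  set l := Real.log n with hl
  have hl0 : 0 < l := by linarith
  have hln : l ≤ n - 1 := Real.log_le_sub_one_of_pos hn0
  set k := ⌈(n : ℝ) / l⌉₊ with hk
  have hk1 : (n : ℝ) / l ≤ k := Nat.le_ceil _
  have hk2 : (k : ℝ) ≤ n / l + 1 := (Nat.ceil_lt_add_one (by positivity)).le
  have hhalf : (n : ℝ) / l ≤ n / 2 := by gcongr
  have hkn : k ≤ n := by
    have : (k : ℝ) ≤ n := by linarith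
    exact_mod_cast this
  have hkpos : (0 : ℝ) < k := hk1.trans_lt' (by positivity)
  have h1 : (n - k) * Real.log k ≤ Real.log n.bell := by
    rw [← Nat.cast_sub hkn, ← Real.log_pow]
    refine Real.log_le_log (by positivity) ?_
    have := Nat.pow_le_bell_add k (n - k)
    rw [Nat.add_sub_cancel' hkn] at this
    exact_mod_cast this
  have h2 : l - Real.log l ≤ Real.log k := by
    rw [hl, ← Real.log_div hn0.ne' hl0.ne']
    exact Real.log_le_log (by positivity) hk1
  have h3 : 0 ≤ Real.log l := Real.log_nonneg (by linarith)
  have h4 : Real.log l ≤ l := Real.log_le_self hl0.le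
  have h5 : (n : ℝ) / l * l = n := by field_simp
  have h6 : (0 : ℝ) ≤ n - k := sub_nonneg.2 (by exact_mod_cast hkn)
  calc
    _ ≤ n * (l - Real.log l) - (n / l + 1) * l := by linarith
    _ ≤ n * (l - Real.log l) - k * (l - Real.log l) := by
      gcongr
      linarith
    _ = (n - k) * (l - Real.log l) := by ring
    _ ≤ (n - k) * Real.log k := by gcongr
    _ ≤ _ := h1

theorem Nat.log_bell_isBigO :
    (fun n : ℕ => Real.log n.bell - n * (Real.log n - Real.log (Real.log n)))
      =O[atTop] (fun n : ℕ => (n : ℝ)) := by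
  refine IsBigO.of_bound 2 ?_
  filter_upwards [eventually_ge_atTop 3,
    (Real.tendsto_log_atTop.comp tendsto_natCast_atTop_atTop).eventually_ge_atTop 2] with n h3 h2
  rw [Real.norm_eq_abs, Real.norm_eq_abs, Nat.abs_cast, abs_le]
  constructor
  · linarith [Nat.le_log_bell h2]
  · linarith [Nat.log_bell_le h3]

/-! ### Upper bound: encoding by incidence lists -/

theorem Monotone.eq_iff_eq_and_eq {ι α : Type*} [Preorder ι] [PartialOrder α] {f : ι → α}
    (hf : Monotone f) {i j k : ι} (hij : i ≤ j) (hjk : j ≤ k) :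
    f i = f k ↔ f i = f j ∧ f j = f k := by
  refine ⟨fun e => ?_, fun e => e.1.trans e.2⟩
  have := (hf hij).antisymm (e ▸ hf hjk)
  exact ⟨this, this.symm.trans e⟩

/-- A monotone function on `Fin (m + 1)` has its kernel determined by the places where it jumps. -/
theorem Monotone.eq_iff_of_castSucc_lt_succ_iff {α β : Type*} [LinearOrder α] [LinearOrder β]
    {m : ℕ} {p : Fin (m + 1) → α} {q : Fin (m + 1) → β} (hp : Monotone p) (hq : Monotone q)
    (h : ∀ i : Fin m, p i.castSucc < p i.succ ↔ q i.castSucc < q i.succ) (j k : Fin (m + 1)) :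
    p j = p k ↔ q j = q k := by
  have h' (i : Fin m) : p i.castSucc = p i.succ ↔ q i.castSucc = q i.succ := by
    have h1 := hp i.castSucc_lt_succ.le
    have h2 := hq i.castSucc_lt_succ.le
    rw [← not_iff_not, ← ne_eq, ← ne_eq, ← h1.lt_iff_ne, ← h2.lt_iff_ne, h]
  wlog hjk : j ≤ k generalizing j k
  · exact eq_comm.trans ((this k j (le_of_not_ge hjk)).trans eq_comm)
  induction k using Fin.induction with
  | zero => simp [Fin.le_zero_iff.1 hjk]
  | succ k ih =>
    rcases hjk.eq_or_lt with rfl | hlt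
    · simp
    have hjk' : j ≤ k.castSucc := Fin.le_castSucc_iff.2 hlt
    rw [hp.eq_iff_eq_and_eq hjk' k.castSucc_lt_succ.le,
      hq.eq_iff_eq_and_eq hjk' k.castSucc_lt_succ.le]
    exact and_congr (ih hjk') (h' k)

namespace OrderedHypergraph

/-- The incidences of `H`, listed by increasing vertex. -/
theorem exists_incidence_list (H : OrderedHypergraph) {n : ℕ} (hn : H.weight = n) :
    ∃ (p : Fin n → H.vertices) (q : Fin n → Fin H.size), Monotone p ∧ p.Surjective ∧
      q.Surjective ∧ ∀ i (v : H.vertices), (v : ℕ+) ∈ H.edge i ↔ ∃ j, p j = v ∧ q j = i := by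
  have hmem {i : Fin H.size} {v : ℕ+} (hv : v ∈ H.edge i) : v ∈ H.vertices :=
    Finset.mem_biUnion.2 ⟨i, Finset.mem_univ i, hv⟩
  -- The lexicographic order makes the vertex coordinate monotone; ties are broken by edge index.
  let α := {x : H.vertices ×ₗ Fin H.size // ((ofLex x).1 : ℕ+) ∈ H.edge (ofLex x).2}
  let g : α ≃ Σ i, H.edge i :=
    { toFun x := ⟨(ofLex x.1).2, (ofLex x.1).1, x.2⟩
      invFun y := ⟨toLex (⟨y.2, hmem y.2.2⟩, y.1), y.2.2⟩
      left_inv _ := rfl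
      right_inv _ := rfl }
  have : Fintype α := Fintype.ofEquiv _ g.symm
  have hcard : Fintype.card α = n := by
    simp [Fintype.card_congr g, ← hn, weight]
  let e : Fin n ≃o α := Fintype.orderIsoFinOfCardEq α hcard
  have hinc (i : Fin H.size) (v : H.vertices) :
      (v : ℕ+) ∈ H.edge i ↔ ∃ j, (ofLex (e j).1).1 = v ∧ (ofLex (e j).1).2 = i := by
    constructor
    · intro hv
      refine ⟨e.symm ⟨toLex (v, i), hv⟩, ?_, ?_⟩ <;> simp
    · rintro ⟨j, rfl, rfl⟩
      exact (e j).2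
  refine ⟨fun j => (ofLex (e j).1).1, fun j => (ofLex (e j).1).2, ?_, ?_, ?_, hinc⟩
  · exact fun j k h => Prod.Lex.monotone_fst_ofLex (e.monotone h)
  · intro v
    obtain ⟨i, -, hi⟩ := Finset.mem_biUnion.1 v.2
    obtain ⟨j, hj, -⟩ := (hinc i v).1 hi
    exact ⟨j, hj⟩
  · intro i
    obtain ⟨v, hv⟩ := H.edge_nonempty i
    obtain ⟨j, -, hj⟩ := (hinc i ⟨v, hmem hv⟩).1 hv
    exact ⟨j, hj⟩

/-- The bijection between the targets of two surjections with the same kernel. -/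
theorem _root_.Function.Surjective.exists_equiv_of_ker_eq {ι α β : Type*} {p : ι → α} {q : ι → β}
    (hp : p.Surjective) (hq : q.Surjective) (h : ∀ j k, p j = p k ↔ q j = q k) :
    ∃ F : α ≃ β, ∀ j, F (p j) = q j := by
  have hpq (j : ι) : q (Function.surjInv hp (p j)) = q j :=
    (h _ _).1 (Function.surjInv_eq hp _)
  refine ⟨Equiv.ofBijective (fun a => q (Function.surjInv hp a)) ⟨fun a b hab => ?_, fun b => ?_⟩,
    hpq⟩
  · simpa [Function.surjInv_eq hp] using (h _ _).2 hab
  · obtain ⟨j, rfl⟩ := hq b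
    exact ⟨p j, hpq j⟩

theorem iso_of_incidence_lists {H K : OrderedHypergraph} {n : ℕ}
    {p : Fin n → H.vertices} {q : Fin n → Fin H.size}
    {p' : Fin n → K.vertices} {q' : Fin n → Fin K.size}
    (hp : Monotone p) (hps : p.Surjective) (hqs : q.Surjective)
    (hinc : ∀ i (v : H.vertices), (v : ℕ+) ∈ H.edge i ↔ ∃ j, p j = v ∧ q j = i)
    (hp' : Monotone p') (hps' : p'.Surjective) (hqs' : q'.Surjective)
    (hinc' : ∀ i (v : K.vertices), (v : ℕ+) ∈ K.edge i ↔ ∃ j, p' j = v ∧ q' j = i)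
    (hpp : ∀ j k, p j = p k ↔ p' j = p' k) (hqq : ∀ j k, q j = q k ↔ q' j = q' k) : Iso H K := by
  obtain ⟨F, hF⟩ := hps.exists_equiv_of_ker_eq hps' hpp
  obtain ⟨f, hf⟩ := hqs.exists_equiv_of_ker_eq hqs' hqq
  have hmono : StrictMono F := by
    intro a b hab
    obtain ⟨j, rfl⟩ := hps a
    obtain ⟨k, rfl⟩ := hps b
    rw [hF, hF]
    exact (hp' (hp.reflect_lt hab).le).lt_of_ne fun h => hab.ne ((hpp j k).2 h)
  refine ⟨hmono.orderIsoOfSurjective F F.surjective, f, fun i v => ?_⟩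
  rw [hinc, hinc']
  refine exists_congr fun j => ?_
  rw [← hF, ← hf]
  simp

/-- The code may depend on the labelling of the edges: only injectivity up to isomorphism is needed,
since one representative per class will be encoded. -/
theorem exists_code (m : ℕ) :
    ∃ code : OrderedHypergraph → Set (Fin m) × Setoid (Fin (m + 1)),
      ∀ H K, H.weight = m + 1 → K.weight = m + 1 → code H = code K → Iso H K := by
  have (H : OrderedHypergraph) : ∃ c : Set (Fin m) × Setoid (Fin (m + 1)), H.weight = m + 1 →
      ∃ (p : Fin (m + 1) → H.vertices) (q : Fin (m + 1) → Fin H.size),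
        (Monotone p ∧ p.Surjective ∧ q.Surjective ∧
          ∀ i (v : H.vertices), (v : ℕ+) ∈ H.edge i ↔ ∃ j, p j = v ∧ q j = i) ∧
        c = ({i | p i.castSucc < p i.succ}, Setoid.ker q) := by
    by_cases h : H.weight = m + 1
    · obtain ⟨p, q, hpq⟩ := H.exists_incidence_list h
      exact ⟨_, fun _ => ⟨p, q, hpq, rfl⟩⟩
    -- Junk value for hypergraphs of another weight.
    · exact ⟨(∅, ⊥), fun h' => absurd h' h⟩
  choose code hcode using this
  refine ⟨code, fun H K hH hK hHK => ?_⟩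
  obtain ⟨p, q, ⟨hp, hps, hqs, hinc⟩, hc⟩ := hcode H hH
  obtain ⟨p', q', ⟨hp', hps', hqs', hinc'⟩, hc'⟩ := hcode K hK
  rw [hc, hc', Prod.mk.injEq] at hHK
  exact iso_of_incidence_lists hp hps hqs hinc hp' hps' hqs' hinc'
    (hp.eq_iff_of_castSucc_lt_succ_iff hp' (Set.ext_iff.1 hHK.1)) (Setoid.ext_iff.1 hHK.2)

theorem finite_and_numAll_le (m : ℕ) :
    (Quotient.mk isoSetoid '' {H | H.weight = m + 1}).Finite ∧
      numAll (m + 1) ≤ 2 ^ m * (m + 1).bell := by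
  obtain ⟨code, hcode⟩ := exists_code m
  have hrep (x : Quotient isoSetoid) : ∃ H, x ∈ Quotient.mk isoSetoid '' {H | H.weight = m + 1} →
      H.weight = m + 1 ∧ Quotient.mk isoSetoid H = x := by
    by_cases hx : x ∈ Quotient.mk isoSetoid '' {H | H.weight = m + 1}
    · obtain ⟨H, hH⟩ := hx
      exact ⟨H, fun _ => hH⟩
    · exact ⟨x.out, fun h => absurd h hx⟩
  choose rep hrep using hrep
  have hinj : Set.InjOn (fun x => code (rep x))
      (Quotient.mk isoSetoid '' {H | H.weight = m + 1}) := fun x hx y hy hxy => by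
    rw [← (hrep x hx).2, ← (hrep y hy).2]
    exact Quotient.sound (hcode _ _ (hrep x hx).1 (hrep y hy).1 hxy)
  have : Finite (Setoid (Fin (m + 1))) := Setoid.finite_of_finite
  refine ⟨Set.Finite.of_injOn (Set.mapsTo_univ _ _) hinj Set.finite_univ, ?_⟩
  have := Set.ncard_le_ncard_of_injOn (t := Set.univ) _ (fun _ _ => Set.mem_univ _) hinj
  simpa [Set.ncard_univ, Nat.card_prod, Setoid.natCard_eq_bell, numAll] using this

/-! ### Lower bound: hypergraphs from partitions -/

/-- The hypergraph on `{1, …, n}` whose edges are the classes of an equivalence relation. -/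
noncomputable def ofSetoid {n : ℕ} (r : Setoid (Fin n)) : OrderedHypergraph where
  size := Nat.card (Quotient r)
  edge i := by
    classical
    exact (Finset.univ.filter fun x => Finite.equivFin (Quotient r) (Quotient.mk r x) = i).map
      (Fin.valEmbedding.trans ⟨Nat.succPNat, Nat.succPNat_injective⟩)
  edge_nonempty i := by
    obtain ⟨x, hx⟩ := Quotient.exists_rep ((Finite.equivFin (Quotient r)).symm i)
    simp only [Finset.map_nonempty]
    exact ⟨x, by simp [hx]⟩

theorem mem_edge_ofSetoid {n : ℕ} (r : Setoid (Fin n)) (i : Fin (ofSetoid r).size) (v : ℕ+) :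
    v ∈ (ofSetoid r).edge i ↔ ∃ x : Fin n,
      Finite.equivFin (Quotient r) (Quotient.mk r x) = i ∧ Nat.succPNat x = v := by
  simp [ofSetoid]

theorem succPNat_mem_edge_ofSetoid {n : ℕ} (r : Setoid (Fin n)) (i : Fin (ofSetoid r).size)
    (x : Fin n) : Nat.succPNat x ∈ (ofSetoid r).edge i ↔
      Finite.equivFin (Quotient r) (Quotient.mk r x) = i := by
  rw [mem_edge_ofSetoid]
  constructor
  · rintro ⟨y, hy, hyx⟩
    rwa [← Fin.ext (Nat.succPNat_injective hyx)]
  · exact fun h => ⟨x, h, rfl⟩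

theorem vertices_ofSetoid {n : ℕ} (r : Setoid (Fin n)) :
    (ofSetoid r).vertices = Finset.univ.image fun x : Fin n => Nat.succPNat x := by
  ext v
  simp only [vertices, Finset.mem_biUnion, mem_edge_ofSetoid, Finset.mem_image, Finset.mem_univ,
    true_and]
  exact ⟨fun ⟨_, x, _, h⟩ => ⟨x, h⟩, fun ⟨x, h⟩ => ⟨_, x, rfl, h⟩⟩

theorem isSimple_ofSetoid {n : ℕ} (r : Setoid (Fin n)) : (ofSetoid r).IsSimple := by
  intro i j hij h
  obtain ⟨v, hv⟩ := (ofSetoid r).edge_nonempty i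
  obtain ⟨x, hx, rfl⟩ := (mem_edge_ofSetoid r i v).1 hv
  rw [h, succPNat_mem_edge_ofSetoid] at hv
  exact hij (hx.symm.trans hv)

theorem weight_ofSetoid {n : ℕ} (r : Setoid (Fin n)) : (ofSetoid r).weight = n := by
  classical
  have := Finset.card_eq_sum_card_fiberwise (s := Finset.univ) (t := Finset.univ)
    (f := fun x : Fin n => Finite.equivFin (Quotient r) (Quotient.mk r x)) (by simp)
  rw [Finset.card_univ, Fintype.card_fin] at this
  simp only [weight, ofSetoid, Finset.card_map]
  convert this.symm
  rfl

/-- A finite linear order has no automorphism but the identity. -/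
theorem iso_coe_apply_of_vertices_eq {s t : Finset ℕ+} (h : s = t) (F : s ≃o t) (v : s) :
    (F v : ℕ+) = v := by
  subst h
  rw [Subsingleton.elim F (OrderIso.refl _)]
  rfl

theorem eq_of_iso_ofSetoid {n : ℕ} {r s : Setoid (Fin n)} (h : Iso (ofSetoid r) (ofSetoid s)) :
    r = s := by
  obtain ⟨F, f, h⟩ := h
  have hmem (i : Fin (ofSetoid r).size) (x : Fin n) :
      Finite.equivFin (Quotient r) (Quotient.mk r x) = i ↔
        Finite.equivFin (Quotient s) (Quotient.mk s x) = f i := by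
    rw [← succPNat_mem_edge_ofSetoid, ← succPNat_mem_edge_ofSetoid]
    have := h i ⟨Nat.succPNat x, by simp [vertices_ofSetoid]⟩
    rwa [iso_coe_apply_of_vertices_eq (by rw [vertices_ofSetoid, vertices_ofSetoid])] at this
  refine Setoid.ext fun x y => ?_
  have hy := (hmem _ y).1 rfl
  have := hmem (Finite.equivFin (Quotient r) (Quotient.mk r y)) x
  rw [← hy] at this
  rw [← Quotient.eq (r := r), ← Quotient.eq (r := s)]
  exact (Equiv.apply_eq_iff_eq _).symm.trans (this.trans (Equiv.apply_eq_iff_eq _))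

/-! ### Assembling the inequalities and the asymptotics -/

theorem numSimple_le_numAll {n : ℕ} (hn : 1 ≤ n) : numSimple n ≤ numAll n := by
  obtain ⟨m, rfl⟩ := Nat.exists_eq_add_of_le' hn
  -- Finiteness matters: `ncard` of an infinite set is 0.
  exact Set.ncard_le_ncard (Set.image_mono fun _ hH => hH.2) (finite_and_numAll_le m).1

theorem bell_le_numSimple {n : ℕ} (hn : 1 ≤ n) : n.bell ≤ numSimple n := by
  obtain ⟨m, rfl⟩ := Nat.exists_eq_add_of_le' hn
  have hfin : (Quotient.mk isoSetoid '' {H | H.IsSimple ∧ H.weight = m + 1}).Finite :=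
    (finite_and_numAll_le m).1.subset (Set.image_mono fun _ hH => hH.2)
  have := Set.ncard_le_ncard_of_injOn (s := Set.univ)
    (t := Quotient.mk isoSetoid '' {H | H.IsSimple ∧ H.weight = m + 1})
    (fun r : Setoid (Fin (m + 1)) => Quotient.mk isoSetoid (ofSetoid r))
    (fun r _ => ⟨ofSetoid r, ⟨isSimple_ofSetoid r, weight_ofSetoid r⟩, rfl⟩)
    (fun r _ s _ h => eq_of_iso_ofSetoid (Quotient.exact h)) hfin
  simpa [Set.ncard_univ, Setoid.natCard_eq_bell, numSimple] using this

theorem numAll_le {n : ℕ} (hn : 1 ≤ n) : numAll n ≤ 2 ^ (n - 1) * n.bell := by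
  obtain ⟨m, rfl⟩ := Nat.exists_eq_add_of_le' hn
  exact (finite_and_numAll_le m).2

end OrderedHypergraph

theorem Nat.log_sub_log_bell_isBigO {a : ℕ → ℕ} (ha : ∀ n, 1 ≤ n → n.bell ≤ a n)
    (ha' : ∀ n, 1 ≤ n → a n ≤ 2 ^ (n - 1) * n.bell) :
    (fun n : ℕ => Real.log (a n) - Real.log n.bell) =O[atTop] (fun n : ℕ => (n : ℝ)) := by
  refine IsBigO.of_bound 1 ?_
  filter_upwards [eventually_ge_atTop 1] with n hn
  have hb : (0 : ℝ) < n.bell := by exact_mod_cast n.bell_pos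
  have h1 : (n.bell : ℝ) ≤ a n := by exact_mod_cast ha n hn
  have h2 : (a n : ℝ) ≤ 2 ^ n * n.bell := by
    have : a n ≤ 2 ^ n * n.bell := (ha' n hn).trans (by gcongr <;> lia)
    exact_mod_cast this
  have h3 := Real.log_le_log hb h1
  have h4 := Real.log_le_log (hb.trans_le h1) h2
  rw [Real.log_mul (by positivity) hb.ne', Real.log_pow] at h4
  have h5 : (n : ℝ) * Real.log 2 ≤ n * 1 := by
    gcongr
    linarith [Real.log_two_lt_d9]
  rw [Real.norm_of_nonneg (by linarith), Real.norm_natCast]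
  linarith

theorem mainTheorem11 :
    (∀ n : ℕ, 1 ≤ n →
      Nat.bell n ≤ OrderedHypergraph.numSimple n ∧
      OrderedHypergraph.numSimple n ≤ OrderedHypergraph.numAll n ∧
      OrderedHypergraph.numAll n ≤ 2 ^ (n - 1) * Nat.bell n) ∧
    -- `log h''_n = log b_n + O(n)`
    (fun n : ℕ => Real.log (OrderedHypergraph.numAll n) - Real.log (Nat.bell n))
      =O[atTop] (fun n : ℕ => (n : ℝ)) ∧
    -- `log h'_n = log b_n + O(n)`
    (fun n : ℕ => Real.log (OrderedHypergraph.numSimple n) - Real.log (Nat.bell n))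
      =O[atTop] (fun n : ℕ => (n : ℝ)) ∧
    -- `log b_n`, `log h''_n` and `log h'_n` are `n * (log n - log log n + O(1))`
    (fun n : ℕ => Real.log (Nat.bell n) - n * (Real.log n - Real.log (Real.log n)))
      =O[atTop] (fun n : ℕ => (n : ℝ)) ∧
    (fun n : ℕ => Real.log (OrderedHypergraph.numAll n)
        - n * (Real.log n - Real.log (Real.log n)))
      =O[atTop] (fun n : ℕ => (n : ℝ)) ∧
    (fun n : ℕ => Real.log (OrderedHypergraph.numSimple n)
        - n * (Real.log n - Real.log (Real.log n)))
      =O[atTop] (fun n : ℕ => (n : ℝ)) := by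

  have hs := Nat.log_sub_log_bell_isBigO (a := OrderedHypergraph.numSimple)
    (fun n hn => OrderedHypergraph.bell_le_numSimple hn)
    (fun n hn => (OrderedHypergraph.numSimple_le_numAll hn).trans (OrderedHypergraph.numAll_le hn))
  have hall := Nat.log_sub_log_bell_isBigO (a := OrderedHypergraph.numAll)
    (fun n hn =>
      (OrderedHypergraph.bell_le_numSimple hn).trans (OrderedHypergraph.numSimple_le_numAll hn))
    (fun n hn => OrderedHypergraph.numAll_le hn)
  refine ⟨fun n hn => ⟨OrderedHypergraph.bell_le_numSimple hn,
    OrderedHypergraph.numSimple_le_numAll hn, OrderedHypergraph.numAll_le hn⟩,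
    hall, hs, Nat.log_bell_isBigO, ?_, ?_⟩
  · simpa using hall.add Nat.log_bell_isBigO
  · simpa using hs.add Nat.log_bell_isBigO
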